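/- Let $d\ge 4$ be an even integer and let $p\in[1,\infty]$ satisfy $p\ge \frac{12d-8}{9d-12}$. For a finite field $\mathbb F_q$ of odd characteristic with $q$ elements, a nontrivial additive character $\chi$ of $\mathbb F_q$, and $j\in\mathbb F_q\setminus\{0\}$, let $$S_j=\{x\in\mathbb F_q^d:\ x_1^2+\dots+x_d^2=j\},\qquad \widehat{f\,d\sigma}(m)=\frac1{|S_j|}\sum_{x\in S_j}\chi(-x\cdot m)f(x)\quad(m\in\mathbb F_q^d)$$ for $f:S_j\to\mathbb C$. Let $R^*(p\to 4)$ be the smallest constant $R\ge 0$ such that $$\Big(\sum_{m\in\mathbb F_q^d}|\widehat{f\,d\sigma}(m)|^4\Big)^{1/4}\le R\,\Big(\frac1{|S_j|}\sum_{x\in S_j}|f(x)|^p\Big)^{1/p}\qquad\text{for all } f:S_j\to\mathbb C$$ (for $p=\infty$ the last norm is $\max_{x\in S_j}|f(x)|$). Then for every $\varepsilon>0$ there is a constant $C>0$, depending only on $d$, $p$ and $\varepsilon$ (and not on $q$, $\chi$ or $j$), such that $$R^*(p\to 4)\le C\,q^{\varepsilon}.$$ Moreover $\frac{12d-8}{9d-12}<\frac{4d-4}{3d-5}$,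 so the range of $p$ is larger than the Tomas–Stein range $p\ge\frac{4d-4}{3d-5}$. -/

import Mathlib

open scoped ENNReal NNReal

/-- The sphere `S_j = {x ∈ F^d : x₁² + ⋯ + x_d² = j}` over a finite field `F`. -/
noncomputable def ffSphere (F : Type*) [Field F] [Fintype F] (d : ℕ) (j : F) :
    Finset (Fin d → F) :=
  open Classical in Finset.univ.filter (fun x => ∑ i, x i ^ 2 = j)

/-- The Fourier transform `(f dσ)^` of the measure `f dσ`, where `dσ` is the normalized surface
measure on `S`: `(f dσ)^(m) = |S|⁻¹ ∑_{x ∈ S} χ(-x·m) f(x)`. -/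
noncomputable def surfaceFourier {F : Type*} [Field F] {d : ℕ}
    (S : Finset (Fin d → F)) (χ : AddChar F ℂ) (f : S → ℂ) (m : Fin d → F) : ℂ :=
  (S.card : ℂ)⁻¹ * ∑ x : S, χ (-((x : Fin d → F) ⬝ᵥ m)) * f x

/-- The `L^p` norm (`1 ≤ p ≤ ∞`) on a finite set in which every point has mass `w > 0`:
`(w ∑ |g|^p)^(1/p)` for finite `p`, and the maximum of `|g|` for `p = ∞`. -/
noncomputable def massLpNorm {α : Type*} [Fintype α] (w : ℝ) (p : ℝ≥0∞) (g : α → ℂ) : ℝ :=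
  open Classical in
  if p = ∞ then ⨆ x, ‖g x‖ else (w * ∑ x, ‖g x‖ ^ p.toReal) ^ (1 / p.toReal)

/-- The extension estimate `‖(f dσ)^‖_{L^r(F^d, dm)} ≤ C ‖f‖_{L^p(S, dσ)}` for all `f : S → ℂ`;
`dm` is counting measure and `dσ` gives every point of `S` the mass `1/|S|`. -/
def ExtensionEstimate {F : Type*} [Field F] [Fintype F] {d : ℕ}
    (S : Finset (Fin d → F)) (χ : AddChar F ℂ) (p r : ℝ≥0∞) (C : ℝ) : Prop :=
  ∀ f : S → ℂ,
    massLpNorm 1 r (surfaceFourier S χ f) ≤ C * massLpNorm ((S.card : ℝ)⁻¹) p f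

/-- `R*(p → r)`: the best (smallest) nonnegative constant in the extension estimate for `S`,
as an extended nonnegative number (`∞` if no constant works). -/
noncomputable def RStar {F : Type*} [Field F] [Fintype F] {d : ℕ}
    (S : Finset (Fin d → F)) (χ : AddChar F ℂ) (p r : ℝ≥0∞) : ℝ≥0∞ :=
  ⨅ (C : ℝ≥0) (_ : ExtensionEstimate S χ p r (C : ℝ)), (C : ℝ≥0∞)

/-! ### Diagonal bilinear forms. -/

section DiagonalForms

variable {F : Type*} [Field F]

/-! Write `d = 2k + 2` and `q = |F|`. If `g` is supported on `E ⊆ S_j` and `|g| ≤ t`, expanding the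
fourth power bounds `‖(g dσ)^‖₄⁴` by `q^d t⁴ |S_j|⁻⁴` times the additive energy of `E`. The heart of
the proof is the energy bound `3(|E|³/q + q^k |E|²)` of `addEnergy_le_of_subset_sphere`.

If `a + b = c + e` on the sphere, then `(a - c)·(b - c) = 0`, so the energy counts right angles with
apex `c ∈ E`. For fixed `c`, the non-isotropic differences `a - c` span distinct lines, and a
second-moment argument (`card_orthogonal_pairs_le`) bounds their orthogonal pairs; summing over all
scalar multiples of these vectors saves a factor `√(q - 1)`. Isotropic differences are controlled on
average over `c`: `a - c` is isotropic exactly when `(1, a)` and `(1, c)` are orthogonal for the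
form `x·x - j t²`, and both lie on its cone. As `d + 1` is odd, Gauss sums cancel, the incidence
counts inside the cone are exact, and the same lemma applies.

Combined with the trivial energy bound `|E|³` and `|S_j| ≥ q^(d-1)/2`, this gives a bound
`3t(|E|/|S_j|)^s` whenever `4s ≤ 3 - 2/d`. Cutting `f` into `O(log q)` dyadic levels costs only
`q^ε`. With `s = 1/p` the condition reads `p ≥ 4d/(3d-2)`, which contains the stated range. -/

theorem addChar_sum_eq_prod {ι : Type*} (χ : AddChar F ℂ) (s : Finset ι) (f : ι → F) :
    χ (∑ i ∈ s, f i) = ∏ i ∈ s, χ (f i) := by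
  classical
  induction s using Finset.induction_on with
  | empty => simp
  | insert a s ha ih => rw [Finset.sum_insert ha, Finset.prod_insert ha, AddChar.map_add_eq_mul, ih]

/-- The diagonal bilinear form with weights `w`. -/
def diagForm {n : ℕ} (w x z : Fin n → F) : F := ∑ i, w i * x i * z i

theorem diagForm_comm {n : ℕ} (w x z : Fin n → F) : diagForm w x z = diagForm w z x := by
  simp only [diagForm, mul_right_comm]

theorem diagForm_add_left {n : ℕ} (w x y z : Fin n → F) :
    diagForm w (x + y) z = diagForm w x z + diagForm w y z := by
  simp only [diagForm, ← Finset.sum_add_distrib, Pi.add_apply]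
  exact Finset.sum_congr rfl fun i _ => by ring

theorem diagForm_smul_left {n : ℕ} (w x z : Fin n → F) (c : F) :
    diagForm w (c • x) z = c * diagForm w x z := by
  simp only [diagForm, Finset.mul_sum, Pi.smul_apply, smul_eq_mul]
  exact Finset.sum_congr rfl fun i _ => by ring

theorem diagForm_smul_right {n : ℕ} (w x z : Fin n → F) (c : F) :
    diagForm w x (c • z) = c * diagForm w x z := by
  rw [diagForm_comm, diagForm_smul_left, diagForm_comm]

theorem diagForm_add_right {n : ℕ} (w x y z : Fin n → F) :
    diagForm w x (y + z) = diagForm w x y + diagForm w x z := by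
  rw [diagForm_comm, diagForm_add_left, diagForm_comm, diagForm_comm w z]

theorem diagForm_self {n : ℕ} (w z : Fin n → F) : diagForm w z z = ∑ i, w i * z i ^ 2 := by
  simp only [diagForm, sq, mul_assoc]

end DiagonalForms

/-! ### Gauss sums and exact counts of orthogonal vectors. -/

section CharacterSums

variable {F : Type*} [Field F] [Fintype F]

theorem sum_addChar_mul [DecidableEq F] {χ : AddChar F ℂ} (hχ : χ ≠ 1) (a : F) :
    ∑ t, χ (t * a) = if a = 0 then (Fintype.card F : ℂ) else 0 := by
  rw [AddChar.sum_mulShift a (AddChar.IsPrimitive.of_ne_one hχ)]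
  split_ifs <;> simp

theorem sum_addChar_sum {n : ℕ} (χ : AddChar F ℂ) (f : Fin n → F → F) :
    ∑ z : Fin n → F, χ (∑ i, f i (z i)) = ∏ i, ∑ x, χ (f i x) := by
  classical
  simp only [addChar_sum_eq_prod]
  rw [Finset.prod_univ_sum, Fintype.piFinset_univ]

theorem sum_addChar_dotProduct [DecidableEq F] {χ : AddChar F ℂ} (hχ : χ ≠ 1) {n : ℕ}
    (p : Fin n → F) :
    ∑ z : Fin n → F, χ (z ⬝ᵥ p) = if p = 0 then (Fintype.card F : ℂ) ^ n else 0 := by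
  have h := sum_addChar_sum χ (fun i x => x * p i)
  simp only [sum_addChar_mul hχ] at h
  simp only [dotProduct]
  rw [h]
  split_ifs with hp
  · simp [hp]
  · obtain ⟨i, hi⟩ := Function.ne_iff.1 hp
    exact Finset.prod_eq_zero (Finset.mem_univ i) (if_neg (by simpa using hi))

/-- The quadratic Gauss sum `∑ₓ χ(a x²)`. -/
noncomputable def quadSum (χ : AddChar F ℂ) (a : F) : ℂ := ∑ x, χ (a * x ^ 2)

/-- An element `y` has `1 + η(y)` square roots, `η` being the quadratic character; the constant `1`
contributes a full nontrivial character sum, which is zero. -/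
theorem quadSum_eq [DecidableEq F] (hF : ringChar F ≠ 2) {χ : AddChar F ℂ} (hχ : χ ≠ 1) {a : F}
    (ha : a ≠ 0) : quadSum χ a = ∑ y, (quadraticChar F y : ℂ) * χ (y * a) := by
  have h1 : quadSum χ a = ∑ y : F, ((quadraticChar F y : ℂ) + 1) * χ (y * a) := by
    unfold quadSum
    rw [← Finset.sum_fiberwise Finset.univ (fun x : F => x ^ 2)]
    refine Finset.sum_congr rfl fun y _ => ?_
    have h2 : ∀ x ∈ Finset.univ.filter (fun x : F => x ^ 2 = y), χ (a * x ^ 2) = χ (y * a) := by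
      intro x hx
      rw [(Finset.mem_filter.1 hx).2, mul_comm]
    rw [Finset.sum_congr rfl h2, Finset.sum_const, nsmul_eq_mul]
    congr 1
    have h3 := quadraticChar_card_sqrts hF y
    have h4 : {x : F | x ^ 2 = y}.toFinset = Finset.univ.filter (fun x : F => x ^ 2 = y) := by
      ext; simp
    rw [h4] at h3
    exact_mod_cast congrArg (Int.cast : ℤ → ℂ) h3
  rw [h1]
  simp only [add_mul, one_mul, Finset.sum_add_distrib, sum_addChar_mul hχ, if_neg ha, add_zero]

theorem quadSum_mul [DecidableEq F] (hF : ringChar F ≠ 2) {χ : AddChar F ℂ} (hχ : χ ≠ 1) {a s : F}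
    (ha : a ≠ 0) (hs : quadraticChar F s = -1) : quadSum χ (s * a) = -quadSum χ a := by
  have hs0 : s ≠ 0 := by rintro rfl; simp at hs
  rw [quadSum_eq hF hχ ha, quadSum_eq hF hχ (mul_ne_zero hs0 ha),
    ← Equiv.sum_comp (Equiv.mulRight₀ s hs0) (fun y => (quadraticChar F y : ℂ) * χ (y * a)),
    ← Finset.sum_neg_distrib]
  refine Finset.sum_congr rfl fun y _ => ?_
  simp [map_mul, hs, mul_assoc]

/-- In odd dimension the Gauss sums of a nondegenerate diagonal form cancel. -/
theorem sum_units_gauss [DecidableEq F] (hF : ringChar F ≠ 2) {χ : AddChar F ℂ} (hχ : χ ≠ 1) {n : ℕ} (hn : Odd n)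
    (w : Fin n → F) (hw : ∀ i, w i ≠ 0) :
    ∑ t : Fˣ, ∑ z : Fin n → F, χ (t * ∑ i, w i * z i ^ 2) = 0 := by
  have h1 (t : Fˣ) : ∑ z : Fin n → F, χ (t * ∑ i, w i * z i ^ 2) = ∏ i, quadSum χ (t * w i) := by
    simp only [quadSum, ← sum_addChar_sum, Finset.mul_sum, mul_assoc]
  obtain ⟨s, hs⟩ := quadraticChar_exists_neg_one hF
  have hs0 : s ≠ 0 := by rintro rfl; simp at hs
  simp only [h1]
  -- Replacing `t` by `s t` with `s` a nonsquare flips the sign of each of the `n` factors. As `n`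
  -- is odd, the sum equals its own negative.
  have h2 : ∑ t : Fˣ, ∏ i, quadSum χ (t * w i) = -∑ t : Fˣ, ∏ i, quadSum χ (t * w i) := by
    conv_lhs => rw [← Equiv.sum_comp (Equiv.mulLeft (Units.mk0 s hs0))]
    rw [← Finset.sum_neg_distrib]
    refine Finset.sum_congr rfl fun t _ => ?_
    have h3 (i : Fin n) : quadSum χ (((Equiv.mulLeft (Units.mk0 s hs0)) t : Fˣ) * w i)
        = (-1 : ℂ) * quadSum χ (t * w i) := by
      simp only [Equiv.coe_mulLeft, Units.val_mul, Units.val_mk0, mul_assoc]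
      rw [quadSum_mul hF hχ (mul_ne_zero t.ne_zero (hw i)) hs, neg_one_mul]
    rw [Finset.prod_congr rfl fun i _ => h3 i, Finset.prod_mul_distrib, Finset.prod_const,
      Finset.card_univ, Fintype.card_fin, hn.neg_one_pow, neg_one_mul]
  exact self_eq_neg.1 h2

theorem sum_eq_zero_add_units [DecidableEq F] (f : F → ℂ) : ∑ t, f t = f 0 + ∑ t : Fˣ, f t := by
  rw [← Finset.add_sum_erase _ _ (Finset.mem_univ (0 : F))]
  congr 1
  refine (Finset.sum_bij (fun (t : Fˣ) _ => (t : F)) ?_ ?_ ?_ ?_).symm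
  · intro t _; simp
  · intro a _ b _ h; exact Units.ext h
  · intro b hb; exact ⟨Units.mk0 b (Finset.ne_of_mem_erase hb), Finset.mem_univ _, rfl⟩
  · intro t _; rfl

theorem sum_addChar_diagForm [DecidableEq F] {χ : AddChar F ℂ} (hχ : χ ≠ 1) {n : ℕ}
    (w : Fin n → F) (hw : ∀ i, w i ≠ 0) (p : Fin n → F) :
    ∑ z : Fin n → F, χ (diagForm w p z) = if p = 0 then (Fintype.card F : ℂ) ^ n else 0 := by
  have h : ∀ z, diagForm w p z = z ⬝ᵥ (w * p) := fun z => by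
    simp only [diagForm, dotProduct, Pi.mul_apply]
    exact Finset.sum_congr rfl fun i _ => by ring
  have h2 : w * p = 0 ↔ p = 0 := by
    simp [funext_iff, hw]
  simp only [h, sum_addChar_dotProduct hχ, h2]

/-- The number of vectors orthogonal to both `x` and `y`, as a character sum. -/
theorem card_orthogonal_pair [DecidableEq F] {χ : AddChar F ℂ} (hχ : χ ≠ 1) {n : ℕ}
    (w x y : Fin n → F) :
    ((Finset.univ.filter fun z => diagForm w x z = 0 ∧ diagForm w y z = 0).card : ℂ)
      * (Fintype.card F : ℂ) ^ 2
      = ∑ z, ∑ u : F, ∑ v : F, χ (diagForm w (u • x + v • y) z) := by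
  have h (z : Fin n → F) : ∑ u : F, ∑ v : F, χ (diagForm w (u • x + v • y) z) =
      if diagForm w x z = 0 ∧ diagForm w y z = 0 then (Fintype.card F : ℂ) ^ 2 else 0 := by
    simp only [diagForm_add_left, diagForm_smul_left, AddChar.map_add_eq_mul, ← Finset.mul_sum,
      ← Finset.sum_mul, sum_addChar_mul hχ]
    by_cases h1 : diagForm w x z = 0 <;> by_cases h2 : diagForm w y z = 0 <;> simp [h1, h2, sq]
  simp only [h, ← Finset.sum_filter, Finset.sum_const, nsmul_eq_mul]

theorem card_orthogonal_pair_of_independent [DecidableEq F] {χ : AddChar F ℂ} (hχ : χ ≠ 1) {n : ℕ}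
    (w : Fin n → F) (hw : ∀ i, w i ≠ 0) (x y : Fin n → F)
    (hxy : ∀ u v : F, u • x + v • y = 0 → u = 0 ∧ v = 0) :
    (Finset.univ.filter fun z => diagForm w x z = 0 ∧ diagForm w y z = 0).card
      * Fintype.card F ^ 2 = Fintype.card F ^ n := by
  have h := card_orthogonal_pair hχ w x y
  rw [Finset.sum_comm] at h
  have h2 (u : F) : ∑ z, ∑ v : F, χ (diagForm w (u • x + v • y) z) =
      if u = 0 then (Fintype.card F : ℂ) ^ n else 0 := by
    rw [Finset.sum_comm]
    simp only [sum_addChar_diagForm hχ w hw]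
    have h3 (v : F) : u • x + v • y = 0 ↔ u = 0 ∧ v = 0 :=
      ⟨hxy u v, fun h => by simp [h.1, h.2]⟩
    simp only [h3]
    by_cases hu : u = 0 <;> simp [hu]
  simp only [h2, Finset.sum_ite_eq', Finset.mem_univ, if_true] at h
  exact_mod_cast h

theorem card_orthogonal_singleton [DecidableEq F] {χ : AddChar F ℂ} (hχ : χ ≠ 1) {n : ℕ}
    (w : Fin n → F) (hw : ∀ i, w i ≠ 0) (x : Fin n → F) (hx : x ≠ 0) :
    (Finset.univ.filter fun z => diagForm w x z = 0).card * Fintype.card F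
      = Fintype.card F ^ n := by
  have h := card_orthogonal_pair hχ w x 0
  rw [Finset.sum_comm] at h
  have h0 : ∀ z : Fin n → F, diagForm w 0 z = 0 := fun z => by simp [diagForm]
  have h2 (u : F) : ∑ z, ∑ v : F, χ (diagForm w (u • x + v • (0 : Fin n → F)) z) =
      if u = 0 then (Fintype.card F : ℂ) ^ n * Fintype.card F else 0 := by
    rw [Finset.sum_comm]
    simp only [sum_addChar_diagForm hχ w hw, smul_zero, add_zero, smul_eq_zero, hx, or_false,
      Finset.sum_const, Finset.card_univ, nsmul_eq_mul]
    by_cases hu : u = 0 <;> simp [hu, mul_comm]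
  simp only [h2, Finset.sum_ite_eq', Finset.mem_univ, if_true, h0, and_true] at h
  have hq : Fintype.card F ≠ 0 := Fintype.card_ne_zero
  have h' : (Finset.univ.filter fun z => diagForm w x z = 0).card * Fintype.card F ^ 2
      = Fintype.card F ^ n * Fintype.card F := by exact_mod_cast h
  exact Nat.eq_of_mul_eq_mul_right (Nat.pos_of_ne_zero hq) (by rw [← h']; ring)

/-- Inside the orthogonal complement of two isotropic vectors of an odd-dimensional space, exactly
one vector out of `q` is isotropic. -/
theorem card_isotropic_orthogonal_pair [DecidableEq F] (hF : ringChar F ≠ 2) {χ : AddChar F ℂ}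
    (hχ : χ ≠ 1) {n : ℕ} (hn : Odd n) (w : Fin n → F) (hw : ∀ i, w i ≠ 0) (x y : Fin n → F)
    (hx : diagForm w x x = 0) (hy : diagForm w y y = 0) :
    (Finset.univ.filter fun z => diagForm w z z = 0 ∧ diagForm w x z = 0 ∧ diagForm w y z = 0).card
      * Fintype.card F
      = (Finset.univ.filter fun z => diagForm w x z = 0 ∧ diagForm w y z = 0).card := by
  set L := (Finset.univ.filter fun z => diagForm w x z = 0 ∧ diagForm w y z = 0).card with hL
  set N := (Finset.univ.filter fun z =>
    diagForm w z z = 0 ∧ diagForm w x z = 0 ∧ diagForm w y z = 0).card with hN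
  have h2F : (2 : F) ≠ 0 := Ring.two_ne_zero hF
  have hq : (Fintype.card F : ℂ) ≠ 0 := Nat.cast_ne_zero.2 Fintype.card_ne_zero
  have h1 : (N : ℂ) * (Fintype.card F : ℂ) ^ 3 = ∑ t : F, ∑ z, ∑ u : F, ∑ v : F,
      χ (t * diagForm w z z + diagForm w (u • x + v • y) z) := by
    have h (z : Fin n → F) : ∑ t : F, ∑ u : F, ∑ v : F,
        χ (t * diagForm w z z + diagForm w (u • x + v • y) z) =
        if diagForm w z z = 0 ∧ diagForm w x z = 0 ∧ diagForm w y z = 0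
          then (Fintype.card F : ℂ) ^ 3 else 0 := by
      simp only [diagForm_add_left, diagForm_smul_left, AddChar.map_add_eq_mul, ← Finset.mul_sum,
        ← Finset.sum_mul, sum_addChar_mul hχ]
      by_cases h0 : diagForm w z z = 0 <;> by_cases h1 : diagForm w x z = 0 <;>
        by_cases h2 : diagForm w y z = 0 <;> simp [h0, h1, h2, pow_succ, mul_assoc]
    rw [Finset.sum_comm]
    simp only [h, ← Finset.sum_filter, Finset.sum_const, nsmul_eq_mul, hN]
  -- The term `t = 0` is `L q²`; the rest of the proof shows that the terms `t ≠ 0` add up to zero.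
  rw [sum_eq_zero_add_units] at h1
  simp only [zero_mul, zero_add, ← card_orthogonal_pair hχ] at h1
  have h3 (t : Fˣ) : ∑ z, ∑ u : F, ∑ v : F,
      χ (t * diagForm w z z + diagForm w (u • x + v • y) z)
      = (∑ z, χ (t * diagForm w z z)) * ∑ u : F, ∑ v : F, χ (-(u * v * diagForm w x y) / 2) := by
    have ht : (t : F) ≠ 0 := t.ne_zero
    -- Complete the square by shifting `z` by `-(u x + v y)/(2t)`. Since `x` and `y` are isotropic,
    -- only the cross term `u v` survives.
    have h4 (u v : F) : ∑ z, χ (t * diagForm w z z + diagForm w (u • x + v • y) z)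
        = (∑ z, χ (t * diagForm w z z)) * χ (-(u * v * diagForm w x y) / (2 * t)) := by
      rw [← Equiv.sum_comp (Equiv.addRight (-(2 * (t : F))⁻¹ • (u • x + v • y))), Finset.sum_mul]
      refine Finset.sum_congr rfl fun z _ => ?_
      rw [← AddChar.map_add_eq_mul]
      congr 1
      simp only [Equiv.coe_addRight, diagForm_add_right, diagForm_add_left, diagForm_smul_left,
        diagForm_smul_right, hx, hy, diagForm_comm w y x, diagForm_comm w z x, diagForm_comm w z y]
      field_simp
      ring
    have h5 : ∑ z, ∑ u : F, ∑ v : F, χ (t * diagForm w z z + diagForm w (u • x + v • y) z)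
        = ∑ u : F, ∑ v : F, ∑ z, χ (t * diagForm w z z + diagForm w (u • x + v • y) z) := by
      rw [Finset.sum_comm]
      exact Finset.sum_congr rfl fun u _ => Finset.sum_comm
    rw [h5]
    simp only [h4, ← Finset.mul_sum]
    congr 1
    -- Rescaling `u` by `t` makes the sum over `u, v` independent of `t`, so it factors out of the
    -- vanishing sum of Gauss sums.
    rw [← Equiv.sum_comp (Equiv.mulLeft₀ (t : F) ht)]
    refine Finset.sum_congr rfl fun u _ => Finset.sum_congr rfl fun v _ => ?_
    congr 1
    simp only [Equiv.mulLeft₀_apply]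
    field_simp
  rw [Finset.sum_congr rfl fun t _ => h3 t, ← Finset.sum_mul] at h1
  simp only [diagForm_self, sum_units_gauss hF hχ hn w hw, zero_mul, add_zero] at h1
  have h6 : N * Fintype.card F ^ 3 = L * Fintype.card F ^ 2 := by exact_mod_cast h1
  exact Nat.eq_of_mul_eq_mul_right (pow_pos (Fintype.card_pos (α := F)) 2) (by rw [← h6]; ring)

end CharacterSums

/-! ### The cone `x·x = j t²` over the sphere, and small counting facts. -/

section Preliminaries

variable {F : Type*} [Field F]

theorem smul_add_smul_eq_zero_imp {n : ℕ} {a b : Fin n → F} (hb : b ≠ 0)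
    (h : ∀ c : F, a ≠ c • b) (u v : F) (huv : u • a + v • b = 0) : u = 0 ∧ v = 0 := by
  have hu : u = 0 := by
    by_contra hu
    refine h (u⁻¹ * -v) ?_
    rw [mul_smul, neg_smul, ← eq_neg_of_add_eq_zero_left huv, inv_smul_smul₀ hu]
  subst hu
  simpa [hb] using huv

theorem diagForm_one {n : ℕ} (x z : Fin n → F) : diagForm (fun _ => 1) x z = x ⬝ᵥ z := by
  simp [diagForm, dotProduct]

/-- The weights of the quadratic form `x₁² + ⋯ + x_d² - j t²`. -/
def coneWeight (d : ℕ) (j : F) : Fin (d + 1) → F := Fin.cons (-j) fun _ => 1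

theorem coneWeight_ne_zero {d : ℕ} {j : F} (hj : j ≠ 0) (i : Fin (d + 1)) :
    coneWeight d j i ≠ 0 := by
  refine Fin.cases ?_ (fun i => ?_) i <;> simp [coneWeight, hj]

theorem diagForm_coneWeight {d : ℕ} (j s t : F) (a b : Fin d → F) :
    diagForm (coneWeight d j) (Fin.cons s a) (Fin.cons t b) = a ⬝ᵥ b - j * s * t := by
  simp only [diagForm, coneWeight, Fin.sum_univ_succ, Fin.cons_zero, Fin.cons_succ, dotProduct,
    one_mul]
  ring

variable [Fintype F]

theorem card_units_real [DecidableEq F] : (Fintype.card Fˣ : ℝ) = Fintype.card F - 1 := by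
  rw [Fintype.card_units, Nat.cast_sub Fintype.card_pos, Nat.cast_one]

theorem card_pow_cancel {m a b c : ℕ} (h : m * Fintype.card F ^ a = Fintype.card F ^ b)
    (hb : b = c + a) : m = Fintype.card F ^ c :=
  Nat.eq_of_mul_eq_mul_right (pow_pos (Fintype.card_pos (α := F)) a) (by rw [h, hb, pow_add])

theorem three_le_card (hF : ringChar F ≠ 2) : 3 ≤ Fintype.card F := by
  have h := FiniteField.odd_card_of_char_ne_two hF
  have h1 := Fintype.one_lt_card (α := F)
  omega

end Preliminaries

/-! ### Second moments of incidences and orthogonal pairs. -/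

section Incidence

/-- The second moment of an incidence count whose point and pair degrees are constant. -/
theorem sum_sq_incidence_sub_mean {α β : Type*} [DecidableEq α] (A : Finset α) (Z : Finset β)
    (r : α → β → Prop) [∀ a z, Decidable (r a z)] (q M : ℝ) (hq : q ≠ 0)
    (hZ : (Z.card : ℝ) = q ^ 2 * M)
    (h1 : ∀ a ∈ A, ((Z.filter fun z => r a z).card : ℝ) = q * M)
    (h2 : ∀ a ∈ A, ∀ b ∈ A, a ≠ b → ((Z.filter fun z => r a z ∧ r b z).card : ℝ) = M) :
    ∑ z ∈ Z, (((A.filter fun a => r a z).card : ℝ) - A.card / q) ^ 2 = A.card * (q - 1) * M := by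
  have e1 : ∑ z ∈ Z, ((A.filter fun a => r a z).card : ℝ) = A.card * (q * M) := by
    simp only [Finset.card_filter, Nat.cast_sum]
    rw [Finset.sum_comm]
    simp only [← Nat.cast_sum, ← Finset.card_filter]
    rw [Nat.cast_sum, Finset.sum_congr rfl h1, Finset.sum_const, nsmul_eq_mul]
  have e2 : ∑ z ∈ Z, ((A.filter fun a => r a z).card : ℝ) ^ 2
      = A.card * (A.card * M) + A.card * (q * M - M) := by
    have h3 : ∀ a ∈ A, ∀ b ∈ A, ((Z.filter fun z => r a z ∧ r b z).card : ℝ)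
        = M + if a = b then q * M - M else 0 := by
      intro a ha b hb
      split_ifs with hab
      · subst hab; simp only [and_self, h1 a ha]; ring
      · rw [h2 a ha b hb hab, add_zero]
    have h4 (z : β) : ((A.filter fun a => r a z).card : ℝ) ^ 2
        = ∑ a ∈ A, ∑ b ∈ A, if r a z ∧ r b z then (1 : ℝ) else 0 := by
      rw [Finset.card_filter, Nat.cast_sum, sq, Finset.sum_mul_sum]
      refine Finset.sum_congr rfl fun a _ => Finset.sum_congr rfl fun b _ => ?_
      by_cases ha : r a z <;> by_cases hb : r b z <;> simp [ha, hb]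
    simp only [h4]
    rw [Finset.sum_comm]
    have h5 : ∀ a ∈ A, ∑ z ∈ Z, ∑ b ∈ A, (if r a z ∧ r b z then (1 : ℝ) else 0)
        = A.card * M + (q * M - M) := by
      intro a ha
      rw [Finset.sum_comm]
      have h6 : ∀ b ∈ A, ∑ z ∈ Z, (if r a z ∧ r b z then (1 : ℝ) else 0)
          = M + if a = b then q * M - M else 0 := by
        intro b hb
        rw [← h3 a ha b hb, Finset.card_filter]
        push_cast
        rfl
      rw [Finset.sum_congr rfl h6, Finset.sum_add_distrib, Finset.sum_const, nsmul_eq_mul,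
        Finset.sum_ite_eq, if_pos ha]
    rw [Finset.sum_congr rfl h5, Finset.sum_const, nsmul_eq_mul]
    ring
  simp only [sub_sq, Finset.sum_add_distrib, Finset.sum_sub_distrib, Finset.sum_const,
    nsmul_eq_mul, ← Finset.sum_mul, ← Finset.mul_sum, e1, e2, hZ]
  field_simp
  ring

variable {F : Type*} [Field F] [Fintype F] [DecidableEq F]

/-- A set of pairwise non-proportional vectors, inside a set `Z` closed under scaling and with
constant incidence degrees, spans few orthogonal pairs. -/
theorem card_orthogonal_pairs_le {n k : ℕ} (w : Fin n → F) (A Z : Finset (Fin n → F))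
    (hZs : ∀ z ∈ Z, ∀ c : Fˣ, (c : F) • z ∈ Z) (hAZ : A ⊆ Z) (hA0 : ∀ a ∈ A, a ≠ 0)
    (hA : ∀ a ∈ A, ∀ b ∈ A, ∀ c : F, a = c • b → a = b)
    (hZ : Z.card = Fintype.card F ^ (2 * k + 2))
    (h1 : ∀ a ∈ A, (Z.filter fun z => diagForm w a z = 0).card = Fintype.card F ^ (2 * k + 1))
    (h2 : ∀ a ∈ A, ∀ b ∈ A, a ≠ b →
      (Z.filter fun z => diagForm w a z = 0 ∧ diagForm w b z = 0).card
        = Fintype.card F ^ (2 * k)) :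
    (((A ×ˢ A).filter fun x => diagForm w x.1 x.2 = 0).card : ℝ)
      ≤ (A.card : ℝ) ^ 2 / Fintype.card F + (Fintype.card F : ℝ) ^ k * A.card := by
  set q : ℝ := (Fintype.card F : ℝ) with hqdef
  have hq1 : 1 < q := by rw [hqdef]; exact_mod_cast Fintype.one_lt_card (α := F)
  have hm := sum_sq_incidence_sub_mean A Z (fun a z => diagForm w a z = 0) q (q ^ (2 * k))
    (by positivity) (by rw [hZ]; push_cast; ring)
    (fun a ha => by rw [h1 a ha]; push_cast; ring)
    (fun a ha b hb hab => by rw [h2 a ha b hb hab]; push_cast; ring)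
  set f : (Fin n → F) → ℝ := fun z =>
    ((A.filter fun a => diagForm w a z = 0).card : ℝ) - A.card / q with hf
  have hfs (c : Fˣ) (z : Fin n → F) : f ((c : F) • z) = f z := by
    simp [hf, diagForm_smul_right]
  -- The deviation `f` is invariant under nonzero scalars, and the `q - 1` dilates of `A` are
  -- disjoint subsets of `Z`. Hence `q - 1` copies of the sum over `A` fit inside the second moment
  -- over `Z`.
  have h3 : (q - 1) * ∑ b ∈ A, f b ^ 2 ≤ (q - 1) * (A.card * q ^ (2 * k)) := by
    have hinj : Set.InjOn (fun x : Fˣ × (Fin n → F) => (x.1 : F) • x.2)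
        ((Finset.univ : Finset Fˣ) ×ˢ A : Finset (Fˣ × (Fin n → F))) := by
      rintro ⟨c, a⟩ hca ⟨e, b⟩ heb h
      simp only [Finset.coe_product, Set.mem_prod, Finset.mem_coe] at hca heb h
      have hab : a = b := hA a hca.2 b heb.2 ((c : F)⁻¹ * e) (by
        rw [mul_smul, ← h, inv_smul_smul₀ c.ne_zero])
      subst hab
      have hce : (c : F) = e := smul_left_injective F (hA0 a hca.2) h
      rw [Units.ext hce]
    have h4 : (q - 1) * ∑ b ∈ A, f b ^ 2
        = ∑ x ∈ (Finset.univ : Finset Fˣ) ×ˢ A, f ((x.1 : F) • x.2) ^ 2 := by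
      rw [Finset.sum_product]
      simp only [hfs, Finset.sum_const, Finset.card_univ, nsmul_eq_mul, card_units_real, hqdef]
    rw [h4, ← Finset.sum_image (f := fun z => f z ^ 2) hinj]
    refine (Finset.sum_le_sum_of_subset_of_nonneg ?_ fun z _ _ => sq_nonneg _).trans
      (hm.trans_le (le_of_eq (by ring)))
    intro z hz
    obtain ⟨x, hx, rfl⟩ := Finset.mem_image.1 hz
    exact hZs _ (hAZ (Finset.mem_product.1 hx).2) _
  have h5 := le_of_mul_le_mul_left h3 (sub_pos.2 hq1)
  have h6 : (((A ×ˢ A).filter fun x => diagForm w x.1 x.2 = 0).card : ℝ)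
      = ∑ b ∈ A, f b + (A.card : ℝ) ^ 2 / q := by
    simp only [hf, Finset.sum_sub_distrib, Finset.sum_const, nsmul_eq_mul]
    rw [Finset.card_filter, Finset.sum_product_right, ← Nat.cast_sum]
    simp only [Finset.card_filter]
    ring
  have h7 : (∑ b ∈ A, f b) ^ 2 ≤ (q ^ k * A.card) ^ 2 := by
    refine sq_sum_le_card_mul_sum_sq.trans ?_
    calc (A.card : ℝ) * ∑ b ∈ A, f b ^ 2 ≤ A.card * (A.card * q ^ (2 * k)) := by gcongr
      _ = _ := by ring
  have h8 := le_of_abs_le (abs_le_of_sq_le_sq h7 (by positivity))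
  rw [h6]
  linarith

theorem card_dotProduct_zero_pairs_le {χ : AddChar F ℂ} (hχ : χ ≠ 1) {d k : ℕ}
    (hd : d = 2 * k + 2) (A : Finset (Fin d → F)) (hA0 : ∀ a ∈ A, a ≠ 0)
    (hA : ∀ a ∈ A, ∀ b ∈ A, ∀ c : F, a = c • b → a = b) :
    (((A ×ˢ A).filter fun x => x.1 ⬝ᵥ x.2 = 0).card : ℝ)
      ≤ (A.card : ℝ) ^ 2 / Fintype.card F + (Fintype.card F : ℝ) ^ k * A.card := by
  have h := card_orthogonal_pairs_le (k := k) (fun _ : Fin d => (1 : F)) A Finset.univ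
    (fun _ _ _ => Finset.mem_univ _) (Finset.subset_univ _) hA0 hA (by simp [hd])
    (fun a ha => card_pow_cancel (a := 1) (by
      rw [pow_one]
      exact card_orthogonal_singleton hχ _ (fun _ => one_ne_zero) a (hA0 a ha)) hd)
    (fun a ha b hb hab => card_pow_cancel (card_orthogonal_pair_of_independent hχ _
      (fun _ => one_ne_zero) a b (smul_add_smul_eq_zero_imp (hA0 b hb)
        fun c hc => hab (hA a ha b hb c hc))) hd)
  simpa only [diagForm_one] using h

theorem mem_ffSphere {d : ℕ} {j : F} {x : Fin d → F} : x ∈ ffSphere F d j ↔ x ⬝ᵥ x = j := by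
  simp [ffSphere, dotProduct, sq]

/-- The case `x = y = 0` of `card_isotropic_orthogonal_pair`: all `q^(d+1)` vectors are orthogonal
to `0`, and one in `q` is isotropic. -/
theorem card_cone (hF : ringChar F ≠ 2) {χ : AddChar F ℂ} (hχ : χ ≠ 1) {d : ℕ} (hd : Even d)
    {j : F} (hj : j ≠ 0) :
    (Finset.univ.filter fun z => diagForm (coneWeight d j) z z = 0).card
      = Fintype.card F ^ d := by
  have h0 : ∀ z, diagForm (coneWeight d j) 0 z = 0 := fun z => by simp [diagForm]
  have h := card_isotropic_orthogonal_pair hF hχ hd.add_one (coneWeight d j)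
    (coneWeight_ne_zero hj) 0 0 (h0 _) (h0 _)
  simp only [h0, and_true, Finset.filter_true, Finset.card_univ, Fintype.card_pi,
    Finset.prod_const, Fintype.card_fin] at h
  exact card_pow_cancel (a := 1) (by rwa [pow_one]) rfl

/-- On the sphere `(a - b)·(a - b) = 2(j - a·b)`, so isotropy of `a - b` means orthogonality of the
lifts `(1, a)` and `(1, b)`. The lifts are pairwise non-proportional points of the cone, whose
incidence degrees are constant because `d + 1` is odd. -/
theorem card_isotropic_pairs_le (hF : ringChar F ≠ 2) {χ : AddChar F ℂ} (hχ : χ ≠ 1) {d k : ℕ}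
    (hd : d = 2 * k + 2) {j : F} (hj : j ≠ 0) (E : Finset (Fin d → F))
    (hE : E ⊆ ffSphere F d j) :
    (((E ×ˢ E).filter fun x => (x.1 - x.2) ⬝ᵥ (x.1 - x.2) = 0).card : ℝ)
      ≤ (E.card : ℝ) ^ 2 / Fintype.card F + (Fintype.card F : ℝ) ^ k * E.card := by
  set w := coneWeight d j with hw
  have hw0 : ∀ i, w i ≠ 0 := coneWeight_ne_zero hj
  have hdodd : Odd (d + 1) := ⟨k + 1, by omega⟩
  set lift : (Fin d → F) → (Fin (d + 1) → F) := fun a => Fin.cons 1 a with hlift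
  have hinj : Function.Injective lift := fun a b h => (Fin.cons_inj.1 h).2
  have hform (a b : Fin d → F) : diagForm w (lift a) (lift b) = a ⬝ᵥ b - j := by
    rw [hw, hlift, diagForm_coneWeight, mul_one, mul_one]
  set A := E.image lift with hA
  set Z := Finset.univ.filter fun z => diagForm w z z = 0 with hZ
  have hA0 : ∀ a ∈ A, a ≠ 0 := by
    intro a ha h
    obtain ⟨x, _, rfl⟩ := Finset.mem_image.1 ha
    simpa [hlift] using congrFun h 0
  have hAs : ∀ a ∈ A, ∀ b ∈ A, ∀ c : F, a = c • b → a = b := by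
    intro a ha b hb c h
    obtain ⟨x, _, rfl⟩ := Finset.mem_image.1 ha
    obtain ⟨y, _, rfl⟩ := Finset.mem_image.1 hb
    have hc : 1 = c := by simpa [hlift] using congrFun h 0
    rw [h, ← hc, one_smul]
  have hAiso : ∀ a ∈ A, diagForm w a a = 0 := by
    intro a ha
    obtain ⟨x, hx, rfl⟩ := Finset.mem_image.1 ha
    rw [hform, mem_ffSphere.1 (hE hx), sub_self]
  have hcone (x y : Fin (d + 1) → F) (hx : diagForm w x x = 0) (hy : diagForm w y y = 0) :=
    card_isotropic_orthogonal_pair hF hχ hdodd w hw0 x y hx hy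
  have h := card_orthogonal_pairs_le (k := k) w A Z
    (fun z hz c => by
      simp only [hZ, Finset.mem_filter, Finset.mem_univ, true_and] at hz ⊢
      rw [diagForm_smul_left, diagForm_smul_right, hz, mul_zero, mul_zero])
    (fun a ha => by simp [hZ, hAiso a ha]) hA0 hAs
    (by rw [hZ, card_cone hF hχ ⟨k + 1, by omega⟩ hj, hd])
    (fun a ha => by
      have h1 := hcone a a (hAiso a ha) (hAiso a ha)
      simp only [and_self] at h1
      rw [hZ, Finset.filter_filter]
      refine card_pow_cancel (a := 2) (b := d + 1) ?_ (by omega)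
      rw [sq, ← mul_assoc, h1, card_orthogonal_singleton hχ w hw0 a (hA0 a ha)])
    (fun a ha b hb hab => by
      rw [hZ, Finset.filter_filter]
      refine card_pow_cancel (a := 3) (b := d + 1) ?_ (by omega)
      rw [pow_succ', ← mul_assoc, hcone a b (hAiso a ha) (hAiso b hb),
        card_orthogonal_pair_of_independent hχ w hw0 a b
          (smul_add_smul_eq_zero_imp (hA0 b hb) fun c hc => hab (hAs a ha b hb c hc))])
  have hcard : A.card = E.card := Finset.card_image_of_injective _ hinj
  rw [hcard] at h
  refine le_trans ?_ h
  have h2F : (2 : F) ≠ 0 := Ring.two_ne_zero hF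
  rw [Nat.cast_le]
  refine Finset.card_le_card_of_injOn (fun x => (lift x.1, lift x.2)) ?_ ?_
  · rintro ⟨a, b⟩ hab
    simp only [Finset.coe_filter, Finset.mem_product, Set.mem_ofPred_eq] at hab ⊢
    refine ⟨⟨Finset.mem_image_of_mem _ hab.1.1, Finset.mem_image_of_mem _ hab.1.2⟩, ?_⟩
    have h3 := hab.2
    rw [sub_dotProduct, dotProduct_sub, dotProduct_sub, mem_ffSphere.1 (hE hab.1.1),
      mem_ffSphere.1 (hE hab.1.2), dotProduct_comm b a] at h3
    rw [hform]
    exact (mul_eq_zero.1 (show (2 : F) * (a ⬝ᵥ b - j) = 0 by linear_combination -h3)).resolve_left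
      h2F
  · rintro ⟨a, b⟩ _ ⟨a', b'⟩ _ hab
    simp only [Prod.mk.injEq] at hab
    rw [hinj hab.1, hinj hab.2]

end Incidence

/-! ### Additive energy of subsets of the sphere, and the size of the sphere. -/

section Energy

variable {F : Type*} [Field F] [Fintype F] [DecidableEq F]

/-- The point `e = a + b - c` lies on the sphere together with `a, b, c` only if the angle at `c` is
right, and `e` is recovered from the other three. -/
theorem addEnergy_le_sum_right_angles {d : ℕ} {j : F} (hF : ringChar F ≠ 2)
    (E : Finset (Fin d → F)) (hE : E ⊆ ffSphere F d j) :
    E.addEnergy E ≤ ∑ c ∈ E, ((E ×ˢ E).filter fun x => (x.1 - c) ⬝ᵥ (x.2 - c) = 0).card := by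
  have h2F : (2 : F) ≠ 0 := Ring.two_ne_zero hF
  rw [← Finset.card_sigma]
  refine Finset.card_le_card_of_injOn (fun x => ⟨x.1.2, (x.1.1, x.2.1)⟩) ?_ ?_
  · rintro ⟨⟨a, c⟩, ⟨b, e⟩⟩ h
    simp only [Finset.coe_filter, Finset.mem_product, Set.mem_ofPred_eq, Finset.coe_sigma,
      Set.mem_sigma_iff, Finset.mem_coe] at h ⊢
    obtain ⟨⟨⟨ha, hc⟩, hb, he⟩, h⟩ := h
    refine ⟨hc, ⟨ha, hb⟩, ?_⟩
    have he' : e = a + b - c := by rw [h]; abel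
    have hee := mem_ffSphere.1 (hE he)
    simp only [he', sub_dotProduct, dotProduct_sub, add_dotProduct, dotProduct_add,
      mem_ffSphere.1 (hE ha), mem_ffSphere.1 (hE hb), mem_ffSphere.1 (hE hc),
      dotProduct_comm b a, dotProduct_comm c a, dotProduct_comm c b] at hee ⊢
    exact (mul_eq_zero.1 (show (2 : F) * _ = 0 by linear_combination hee)).resolve_left h2F
  · rintro ⟨⟨a, c⟩, ⟨b, e⟩⟩ h ⟨⟨a', c'⟩, ⟨b', e'⟩⟩ h' heq
    simp only [Finset.coe_filter, Finset.mem_product, Set.mem_ofPred_eq, Sigma.mk.injEq,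
      heq_eq_eq, Prod.mk.injEq] at h h' heq
    obtain ⟨rfl, rfl, rfl⟩ := heq
    have : e = e' := add_left_cancel (h.2.symm.trans h'.2)
    rw [this]

theorem addEnergy_le_card_pow_three {V : Type*} [AddCommGroup V] [DecidableEq V]
    (E : Finset V) : E.addEnergy E ≤ E.card ^ 3 := by
  have h : (E ×ˢ E ×ˢ E).card = E.card ^ 3 := by simp [Finset.card_product, pow_succ, mul_assoc]
  rw [← h]
  refine Finset.card_le_card_of_injOn (fun x => (x.1.2, (x.1.1, x.2.1))) ?_ ?_
  · rintro ⟨⟨a, c⟩, ⟨b, e⟩⟩ h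
    simp only [Finset.coe_filter, Finset.mem_product, Set.mem_ofPred_eq, Finset.mem_coe] at h ⊢
    exact ⟨h.1.1.2, h.1.1.1, h.1.2.1⟩
  · rintro ⟨⟨a, c⟩, ⟨b, e⟩⟩ h ⟨⟨a', c'⟩, ⟨b', e'⟩⟩ h' heq
    simp only [Finset.coe_filter, Finset.mem_product, Set.mem_ofPred_eq,
      Prod.mk.injEq] at h h' heq
    obtain ⟨rfl, rfl, rfl⟩ := heq
    have : e = e' := add_left_cancel (h.2.symm.trans h'.2)
    rw [this]

/-- The additive energy of a subset of a sphere in even dimension `2k + 2`. -/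
theorem addEnergy_le_of_subset_sphere (hF : ringChar F ≠ 2) {χ : AddChar F ℂ} (hχ : χ ≠ 1)
    {d k : ℕ} (hd : d = 2 * k + 2) {j : F} (hj : j ≠ 0) (E : Finset (Fin d → F))
    (hE : E ⊆ ffSphere F d j) :
    (E.addEnergy E : ℝ) ≤
      3 * ((E.card : ℝ) ^ 3 / Fintype.card F + (Fintype.card F : ℝ) ^ k * (E.card : ℝ) ^ 2) := by
  set q : ℝ := (Fintype.card F : ℝ) with hq
  have hq0 : 0 < q := by rw [hq]; exact_mod_cast Fintype.card_pos (α := F)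
  set iso : (Fin d → F) → Finset (Fin d → F) := fun c =>
    E.filter fun a => (a - c) ⬝ᵥ (a - c) = 0 with hiso
  set non : (Fin d → F) → Finset (Fin d → F) := fun c =>
    (E.filter fun a => (a - c) ⬝ᵥ (a - c) ≠ 0).image (· - c) with hnon
  -- Pairs with an isotropic leg are counted trivially here; the sizes of `iso c` become small only
  -- after summation over `c`.
  have hfib (c : Fin d → F) (hc : c ∈ E) :
      (((E ×ˢ E).filter fun x => (x.1 - c) ⬝ᵥ (x.2 - c) = 0).card : ℝ)
        ≤ 2 * E.card * (iso c).card + ((E.card : ℝ) ^ 2 / q + q ^ k * E.card) := by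
    have h1 : ((non c ×ˢ non c).filter fun x => x.1 ⬝ᵥ x.2 = 0).card
        ≤ (E.card : ℝ) ^ 2 / q + q ^ k * E.card := by
      have hcj := mem_ffSphere.1 (hE hc)
      have hle : ((non c).card : ℝ) ≤ E.card := by
        exact_mod_cast Finset.card_image_le.trans (Finset.card_filter_le _ _)
      -- The second equation says that `a + c` is on the sphere. On a non-isotropic line it has just
      -- one nonzero solution, so distinct members of `non c` are never proportional.
      have hmem : ∀ a ∈ non c, a ⬝ᵥ a ≠ 0 ∧ a ⬝ᵥ a + 2 * (a ⬝ᵥ c) = 0 := by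
        intro a ha
        obtain ⟨x, hx, rfl⟩ := Finset.mem_image.1 ha
        obtain ⟨hxE, hx⟩ := Finset.mem_filter.1 hx
        refine ⟨hx, ?_⟩
        simp only [sub_dotProduct, dotProduct_sub, mem_ffSphere.1 (hE hxE), hcj,
          dotProduct_comm c x]
        ring
      refine (card_dotProduct_zero_pairs_le hχ hd (non c) ?_ ?_).trans ?_
      · rintro a ha rfl
        exact (hmem 0 ha).1 (by simp)
      · intro a ha b hb e hab
        obtain ⟨ha0, ha1⟩ := hmem a ha
        obtain ⟨hb0, hb1⟩ := hmem b hb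
        rw [hab] at ha0 ha1
        simp only [smul_dotProduct, dotProduct_smul, smul_eq_mul] at ha0 ha1
        have he : e ≠ 0 := by rintro rfl; simp at ha0
        have h2 : e * (b ⬝ᵥ b) * (e - 1) = 0 := by linear_combination ha1 - e * hb1
        have h3 : e - 1 = 0 := (mul_eq_zero.1 h2).resolve_left (mul_ne_zero he hb0)
        rw [hab, sub_eq_zero.1 h3, one_smul]
      · gcongr
    have h2 : ((E ×ˢ E).filter fun x => (x.1 - c) ⬝ᵥ (x.2 - c) = 0).card ≤
        (iso c).card * E.card + E.card * (iso c).card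
          + ((non c ×ˢ non c).filter fun x => x.1 ⬝ᵥ x.2 = 0).card := by
      have h3 : ((E ×ˢ E).filter fun x => (x.1 - c) ⬝ᵥ (x.2 - c) = 0).card ≤
          ((iso c ×ˢ E ∪ E ×ˢ iso c).image (fun x => (x.1 - c, x.2 - c))
            ∪ (non c ×ˢ non c).filter fun x => x.1 ⬝ᵥ x.2 = 0).card := by
        refine Finset.card_le_card_of_injOn (fun x => (x.1 - c, x.2 - c)) ?_ ?_
        · rintro ⟨a, b⟩ hab
          simp only [Finset.coe_filter, Finset.mem_product, Set.mem_ofPred_eq] at hab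
          obtain ⟨⟨ha, hb⟩, hab⟩ := hab
          by_cases ha0 : (a - c) ⬝ᵥ (a - c) = 0
          · refine Finset.mem_union_left _ (Finset.mem_image_of_mem _ (Finset.mem_union_left _ ?_))
            exact Finset.mem_product.2 ⟨Finset.mem_filter.2 ⟨ha, ha0⟩, hb⟩
          by_cases hb0 : (b - c) ⬝ᵥ (b - c) = 0
          · refine Finset.mem_union_left _
              (Finset.mem_image_of_mem _ (Finset.mem_union_right _ ?_))
            exact Finset.mem_product.2 ⟨ha, Finset.mem_filter.2 ⟨hb, hb0⟩⟩
          refine Finset.mem_union_right _ (Finset.mem_filter.2 ⟨Finset.mem_product.2 ⟨?_, ?_⟩, hab⟩)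
          · exact Finset.mem_image_of_mem _ (Finset.mem_filter.2 ⟨ha, ha0⟩)
          · exact Finset.mem_image_of_mem _ (Finset.mem_filter.2 ⟨hb, hb0⟩)
        · rintro ⟨a, b⟩ _ ⟨a', b'⟩ _ h
          simpa using h
      refine h3.trans ((Finset.card_union_le _ _).trans (Nat.add_le_add_right ?_ _))
      refine Finset.card_image_le.trans ((Finset.card_union_le _ _).trans ?_)
      rw [Finset.card_product, Finset.card_product]
    have h2' : (((E ×ˢ E).filter fun x => (x.1 - c) ⬝ᵥ (x.2 - c) = 0).card : ℝ) ≤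
        (iso c).card * E.card + E.card * (iso c).card
          + ((non c ×ˢ non c).filter fun x => x.1 ⬝ᵥ x.2 = 0).card := by exact_mod_cast h2
    linarith
  have hsum : ∑ c ∈ E, ((iso c).card : ℝ) ≤ (E.card : ℝ) ^ 2 / q + q ^ k * E.card := by
    refine le_trans (le_of_eq ?_) (card_isotropic_pairs_le hF hχ hd hj E hE)
    rw [Finset.card_filter, Finset.sum_product_right, ← Nat.cast_sum]
    simp only [hiso, Finset.card_filter]
  calc (E.addEnergy E : ℝ)
      ≤ ∑ c ∈ E, (((E ×ˢ E).filter fun x => (x.1 - c) ⬝ᵥ (x.2 - c) = 0).card : ℝ) := by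
        exact_mod_cast addEnergy_le_sum_right_angles hF E hE
    _ ≤ ∑ c ∈ E, (2 * E.card * (iso c).card + ((E.card : ℝ) ^ 2 / q + q ^ k * E.card)) :=
        Finset.sum_le_sum hfib
    _ = 2 * E.card * ∑ c ∈ E, ((iso c).card : ℝ)
          + E.card * ((E.card : ℝ) ^ 2 / q + q ^ k * E.card) := by
        rw [Finset.sum_add_distrib, ← Finset.mul_sum, Finset.sum_const, nsmul_eq_mul]
    _ ≤ 2 * E.card * ((E.card : ℝ) ^ 2 / q + q ^ k * E.card)
          + E.card * ((E.card : ℝ) ^ 2 / q + q ^ k * E.card) := by gcongr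
    _ = _ := by ring

/-- The last `m` coordinates determine the first up to sign. -/
theorem card_isotropic_le {m : ℕ} :
    (Finset.univ.filter fun a : Fin (m + 1) → F => a ⬝ᵥ a = 0).card
      ≤ 2 * Fintype.card F ^ m := by
  set I := Finset.univ.filter fun a : Fin (m + 1) → F => a ⬝ᵥ a = 0 with hI
  have hsplit (a : Fin (m + 1) → F) : a ⬝ᵥ a = a 0 * a 0 + Fin.tail a ⬝ᵥ Fin.tail a := by
    simp [dotProduct, Fin.sum_univ_succ, Fin.tail]
  have h : I.card ≤ 2 * (I.image Fin.tail).card := by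
    refine Finset.card_le_mul_card_image (f := Fin.tail (α := fun _ : Fin (m + 1) => F)) I 2 ?_
    intro b hb
    obtain ⟨a, ha, rfl⟩ := Finset.mem_image.1 hb
    refine (Finset.card_le_card (t := {a, Fin.cons (-a 0) (Fin.tail a)}) ?_).trans
      Finset.card_le_two
    intro x hx
    obtain ⟨hxI, hx⟩ := Finset.mem_filter.1 hx
    have hx0 := (Finset.mem_filter.1 hxI).2
    have ha0 := (Finset.mem_filter.1 ha).2
    rw [hsplit] at hx0 ha0
    rw [hx] at hx0
    rcases mul_self_eq_mul_self_iff.1 (show x 0 * x 0 = a 0 * a 0 by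
      linear_combination hx0 - ha0) with h | h
    · refine Finset.mem_insert.2 (Or.inl ?_)
      rw [← Fin.cons_self_tail x, ← Fin.cons_self_tail a, hx, h]
    · refine Finset.mem_insert.2 (Or.inr (Finset.mem_singleton.2 ?_))
      rw [← h, ← hx, Fin.cons_self_tail]
  refine h.trans (Nat.mul_le_mul_left _ ((Finset.card_le_univ _).trans ?_))
  simp

/-- The `q^(m+1)` cone points with nonzero first coordinate are multiples of lifted sphere points,
and the others are isotropic vectors. Hence `(q - 2) q^m ≤ (q - 1)|S|`, and `q ≥ 3` gives the factor
`2`. -/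
theorem card_ffSphere_ge (hF : ringChar F ≠ 2) {χ : AddChar F ℂ} (hχ : χ ≠ 1) {m : ℕ}
    (hm : Even (m + 1)) {j : F} (hj : j ≠ 0) :
    (Fintype.card F : ℝ) ^ m ≤ 2 * (ffSphere F (m + 1) j).card := by
  set S := ffSphere F (m + 1) j with hS
  set I := Finset.univ.filter fun a : Fin (m + 1) → F => a ⬝ᵥ a = 0 with hI
  set q : ℝ := (Fintype.card F : ℝ) with hq
  have hq3 : (3 : ℝ) ≤ q := by rw [hq]; exact_mod_cast three_le_card hF
  have hcone : (Finset.univ.filter fun z => diagForm (coneWeight (m + 1) j) z z = 0) ⊆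
      ((Finset.univ : Finset Fˣ) ×ˢ S).image
        (fun x => (x.1 : F) • (Fin.cons 1 x.2 : Fin (m + 1 + 1) → F))
      ∪ I.image (fun a => (Fin.cons 0 a : Fin (m + 1 + 1) → F)) := by
    intro z hz
    have hz := (Finset.mem_filter.1 hz).2
    rw [← Fin.cons_self_tail z, diagForm_coneWeight] at hz
    by_cases h0 : z 0 = 0
    · refine Finset.mem_union_right _ (Finset.mem_image.2 ⟨Fin.tail z, ?_, ?_⟩)
      · simpa [hI, h0] using hz
      · rw [← h0, Fin.cons_self_tail]
    · refine Finset.mem_union_left _ (Finset.mem_image.2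
        ⟨(Units.mk0 _ h0, (z 0)⁻¹ • Fin.tail z), ?_, ?_⟩)
      · simp only [Finset.mem_product, Finset.mem_univ, true_and, hS, mem_ffSphere,
          smul_dotProduct, dotProduct_smul, smul_eq_mul]
        field_simp
        linear_combination hz
      · ext i
        refine Fin.cases ?_ (fun i => ?_) i
        · simp
        · simp [Fin.tail, h0]
  have h1 := (Finset.card_le_card hcone).trans (Finset.card_union_le _ _)
  rw [card_cone hF hχ hm hj] at h1
  have h2 := h1.trans (Nat.add_le_add Finset.card_image_le
    (Finset.card_image_le.trans card_isotropic_le))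
  rw [Finset.card_product, Finset.card_univ] at h2
  have h3 : q ^ (m + 1) ≤ (q - 1) * S.card + 2 * q ^ m := by
    rw [hq, ← card_units_real]
    exact_mod_cast h2
  rw [pow_succ] at h3
  have h4 : 0 ≤ q ^ m := by positivity
  nlinarith

end Energy

/-! ### Weighted `L^p` norms. -/

section MassLpNorm

variable {α : Type*} [Fintype α]

theorem massLpNorm_top (w : ℝ) (g : α → ℂ) : massLpNorm w ∞ g = ⨆ x, ‖g x‖ := by
  rw [massLpNorm, if_pos rfl]

theorem massLpNorm_of_ne_top (w : ℝ) {p : ℝ≥0∞} (hp : p ≠ ∞) (g : α → ℂ) :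
    massLpNorm w p g = (w * ∑ x, ‖g x‖ ^ p.toReal) ^ (1 / p.toReal) := by
  rw [massLpNorm, if_neg hp]

theorem massLpNorm_four (g : α → ℂ) :
    massLpNorm 1 4 g = (∑ x, ‖g x‖ ^ (4 : ℝ)) ^ (1 / (4 : ℝ)) := by
  rw [massLpNorm_of_ne_top _ (by simp), one_mul, ENNReal.toReal_ofNat]

theorem massLpNorm_four_le {g : α → ℂ} {B : ℝ} (hB : 0 ≤ B) (h : ∑ x, ‖g x‖ ^ 4 ≤ B ^ 4) :
    massLpNorm 1 4 g ≤ B := by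
  rw [massLpNorm_four]
  calc (∑ x, ‖g x‖ ^ (4 : ℝ)) ^ (1 / (4 : ℝ)) ≤ (B ^ (4 : ℝ)) ^ (1 / (4 : ℝ)) := by
        refine Real.rpow_le_rpow (Finset.sum_nonneg fun x _ => by positivity) ?_ (by norm_num)
        exact_mod_cast h
    _ = B := by rw [← Real.rpow_mul hB]; norm_num

theorem massLpNorm_four_add_le (f g : α → ℂ) :
    massLpNorm 1 4 (f + g) ≤ massLpNorm 1 4 f + massLpNorm 1 4 g := by
  simp only [massLpNorm_four]
  refine le_trans ?_ (Real.Lp_add_le_of_nonneg Finset.univ (p := 4) (by norm_num)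
    (fun i _ => norm_nonneg (f i)) (fun i _ => norm_nonneg (g i)))
  refine Real.rpow_le_rpow (Finset.sum_nonneg fun x _ => by positivity)
    (Finset.sum_le_sum fun x _ => ?_) (by norm_num)
  exact Real.rpow_le_rpow (norm_nonneg _) (norm_add_le _ _) (by norm_num)

theorem massLpNorm_nonneg {w : ℝ} (hw : 0 ≤ w) (p : ℝ≥0∞) (g : α → ℂ) : 0 ≤ massLpNorm w p g := by
  by_cases hp : p = ∞
  · subst hp
    rw [massLpNorm_top]
    exact Real.iSup_nonneg fun x => norm_nonneg _
  · rw [massLpNorm_of_ne_top w hp]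
    exact Real.rpow_nonneg (mul_nonneg hw (Finset.sum_nonneg fun x _ => by positivity)) _

/-- Chebyshev's inequality; for `p = ∞` the exponent `1 / p.toReal` is `0`. -/
theorem mul_card_rpow_le_massLpNorm {w : ℝ} (hw : 0 ≤ w) {p : ℝ≥0∞} (hp0 : p ≠ 0) (f : α → ℂ)
    (E : Finset α) (hE : E.Nonempty) {t : ℝ} (ht : 0 ≤ t) (h : ∀ x ∈ E, t ≤ ‖f x‖) :
    t * (w * E.card) ^ (1 / p.toReal) ≤ massLpNorm w p f := by
  by_cases hp : p = ∞
  · subst hp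
    obtain ⟨x, hx⟩ := hE
    rw [massLpNorm_top]
    simpa using (h x hx).trans
      (le_ciSup (f := fun x => ‖f x‖) (Set.finite_range _).bddAbove x)
  · have hp' : 0 < p.toReal := ENNReal.toReal_pos hp0 hp
    rw [massLpNorm_of_ne_top w hp]
    calc t * (w * E.card) ^ (1 / p.toReal)
        = (t ^ p.toReal) ^ (1 / p.toReal) * (w * E.card) ^ (1 / p.toReal) := by
          rw [← Real.rpow_mul ht, mul_one_div_cancel hp'.ne', Real.rpow_one]
      _ = (w * (E.card * t ^ p.toReal)) ^ (1 / p.toReal) := by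
          rw [← Real.mul_rpow (by positivity) (by positivity)]
          congr 1
          ring
      _ ≤ _ := by
          refine Real.rpow_le_rpow (by positivity) ?_ (by positivity)
          refine mul_le_mul_of_nonneg_left ?_ hw
          rw [← nsmul_eq_mul, ← Finset.sum_const]
          refine (Finset.sum_le_sum fun x hx => Real.rpow_le_rpow ht (h x hx) hp'.le).trans ?_
          exact Finset.sum_le_sum_of_subset_of_nonneg (Finset.subset_univ _)
            fun x _ _ => by positivity

end MassLpNorm

/-! ### Fourth moments and additive energy. -/

section Fourier

variable {F : Type*} [Field F]

theorem surfaceFourier_add {d : ℕ} (S : Finset (Fin d → F)) (χ : AddChar F ℂ) (f g : S → ℂ) :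
    surfaceFourier S χ (f + g) = surfaceFourier S χ f + surfaceFourier S χ g := by
  ext m
  simp only [surfaceFourier, Pi.add_apply, mul_add, Finset.sum_add_distrib]

variable [Fintype F]

/-- The fourth moment of an exponential sum is controlled by the additive energy. -/
theorem sum_norm_pow_four_le [DecidableEq F] {χ : AddChar F ℂ} (hχ : χ ≠ 1) {d : ℕ}
    (E : Finset (Fin d → F)) (G : (Fin d → F) → ℂ) {t : ℝ} (ht : 0 ≤ t)
    (hG : ∀ x ∈ E, ‖G x‖ ≤ t) :
    ∑ m, ‖∑ x ∈ E, χ (-(x ⬝ᵥ m)) * G x‖ ^ 4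
      ≤ (Fintype.card F : ℝ) ^ d * t ^ 4 * E.addEnergy E := by
  set H : (Fin d → F) × (Fin d → F) → ℂ := fun p => G p.1 * starRingEnd ℂ (G p.2) with hH
  have h1 (m : Fin d → F) : ((‖∑ x ∈ E, χ (-(x ⬝ᵥ m)) * G x‖ ^ 2 : ℝ) : ℂ)
      = ∑ p ∈ E ×ˢ E, χ (m ⬝ᵥ (p.2 - p.1)) * H p := by
    rw [Complex.ofReal_pow, ← Complex.mul_conj', map_sum, Finset.sum_mul_sum, Finset.sum_product]
    refine Finset.sum_congr rfl fun a _ => Finset.sum_congr rfl fun c _ => ?_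
    have h2 : m ⬝ᵥ (c - a) = -(a ⬝ᵥ m) + c ⬝ᵥ m := by
      rw [dotProduct_sub, dotProduct_comm m c, dotProduct_comm m a]; ring
    rw [map_mul, ← AddChar.map_neg_eq_conj, neg_neg, h2, AddChar.map_add_eq_mul]
    simp only [hH]
    ring
  have h2 (m : Fin d → F) : ((‖∑ x ∈ E, χ (-(x ⬝ᵥ m)) * G x‖ ^ 4 : ℝ) : ℂ)
      = ∑ x ∈ (E ×ˢ E) ×ˢ E ×ˢ E,
        χ (m ⬝ᵥ ((x.1.2 + x.2.2) - (x.1.1 + x.2.1))) * (H x.1 * H x.2) := by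
    rw [show 4 = 2 + 2 from rfl, pow_add, Complex.ofReal_mul, h1, Finset.sum_mul_sum,
      ← Finset.sum_product']
    refine Finset.sum_congr rfl fun x _ => ?_
    rw [show (x.1.2 + x.2.2) - (x.1.1 + x.2.1) = (x.1.2 - x.1.1) + (x.2.2 - x.2.1) by abel,
      dotProduct_add, AddChar.map_add_eq_mul]
    ring
  have h3 : ((∑ m, ‖∑ x ∈ E, χ (-(x ⬝ᵥ m)) * G x‖ ^ 4 : ℝ) : ℂ)
      = ∑ x ∈ ((E ×ˢ E) ×ˢ E ×ˢ E).filter fun x => x.1.1 + x.2.1 = x.1.2 + x.2.2,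
        (Fintype.card F : ℂ) ^ d * (H x.1 * H x.2) := by
    rw [Complex.ofReal_sum]
    simp only [h2]
    rw [Finset.sum_comm, Finset.sum_filter]
    refine Finset.sum_congr rfl fun x _ => ?_
    rw [← Finset.sum_mul, sum_addChar_dotProduct hχ]
    simp only [sub_eq_zero, eq_comm (a := x.1.2 + x.2.2), ite_mul, zero_mul]
  have hHt : ∀ p ∈ E ×ˢ E, ‖H p‖ ≤ t * t := by
    intro p hp
    rw [hH, norm_mul, RCLike.norm_conj]
    exact mul_le_mul (hG _ (Finset.mem_product.1 hp).1) (hG _ (Finset.mem_product.1 hp).2)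
      (norm_nonneg _) ht
  have h4 : ‖((∑ m, ‖∑ x ∈ E, χ (-(x ⬝ᵥ m)) * G x‖ ^ 4 : ℝ) : ℂ)‖
      = ∑ m, ‖∑ x ∈ E, χ (-(x ⬝ᵥ m)) * G x‖ ^ 4 := by
    rw [Complex.norm_real, Real.norm_of_nonneg (Finset.sum_nonneg fun m _ => by positivity)]
  rw [← h4, h3]
  refine (norm_sum_le _ _).trans ?_
  have h5 : ∀ x ∈ ((E ×ˢ E) ×ˢ E ×ˢ E).filter fun x => x.1.1 + x.2.1 = x.1.2 + x.2.2,
      ‖(Fintype.card F : ℂ) ^ d * (H x.1 * H x.2)‖ ≤ (Fintype.card F : ℝ) ^ d * t ^ 4 := by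
    intro x hx
    have hx := Finset.mem_product.1 (Finset.mem_filter.1 hx).1
    rw [norm_mul, norm_pow, Complex.norm_natCast, norm_mul]
    refine mul_le_mul_of_nonneg_left ?_ (by positivity)
    calc ‖H x.1‖ * ‖H x.2‖ ≤ (t * t) * (t * t) :=
          mul_le_mul (hHt _ hx.1) (hHt _ hx.2) (norm_nonneg _) (by positivity)
      _ = t ^ 4 := by ring
  refine (Finset.sum_le_card_nsmul _ _ _ h5).trans ?_
  rw [nsmul_eq_mul, mul_comm, Finset.addEnergy]

theorem sum_norm_surfaceFourier_pow_four_le [DecidableEq F] {χ : AddChar F ℂ} (hχ : χ ≠ 1) {d : ℕ}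
    (S : Finset (Fin d → F)) (E : Finset S) (g : S → ℂ) {t : ℝ} (ht : 0 ≤ t)
    (hg : ∀ x, ‖g x‖ ≤ t) (hg0 : ∀ x, x ∉ E → g x = 0) :
    ∑ m, ‖surfaceFourier S χ g m‖ ^ 4
      ≤ (Fintype.card F : ℝ) ^ d / (S.card : ℝ) ^ 4 * t ^ 4
        * (E.map (Function.Embedding.subtype _)).addEnergy
            (E.map (Function.Embedding.subtype _)) := by
  set G : (Fin d → F) → ℂ := fun x => if h : x ∈ S then g ⟨x, h⟩ else 0 with hG
  have hGx (x : S) : G x = g x := by simp [hG]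
  have h1 (m : Fin d → F) : surfaceFourier S χ g m = (S.card : ℂ)⁻¹ *
      ∑ x ∈ E.map (Function.Embedding.subtype _), χ (-(x ⬝ᵥ m)) * G x := by
    rw [surfaceFourier, Finset.sum_map]
    congr 1
    simp only [Function.Embedding.subtype_apply, hGx]
    exact (Finset.sum_subset (Finset.subset_univ E) fun x _ hx => by
      rw [hg0 x hx, mul_zero]).symm
  have h2 := sum_norm_pow_four_le hχ (E.map (Function.Embedding.subtype _)) G ht (by
    intro x hx
    obtain ⟨y, _, rfl⟩ := Finset.mem_map.1 hx
    simpa [hGx] using hg y)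
  simp only [h1, norm_mul, norm_inv, Complex.norm_natCast, mul_pow, ← Finset.mul_sum]
  calc ((S.card : ℝ)⁻¹) ^ 4 * _ ≤ ((S.card : ℝ)⁻¹) ^ 4 * _ :=
        mul_le_mul_of_nonneg_left h2 (by positivity)
    _ = _ := by rw [inv_pow]; ring

end Fourier

/-! ### Arithmetic of the exponents. -/

section Numerics

theorem le_exp_convexComb {x u v l : ℝ} (hu : x ≤ Real.exp u) (hv : x ≤ Real.exp v) (h0 : 0 ≤ l)
    (h1 : l ≤ 1) : x ≤ Real.exp ((1 - l) * u + l * v) := by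
  rcases le_total u v with h | h
  · exact hu.trans (Real.exp_le_exp.2 (by nlinarith))
  · exact hv.trans (Real.exp_le_exp.2 (by nlinarith))

/-- Here `n = |E|`, `N = |S_j|` and `L` is the energy. If `n³/q` dominates, `q^(2k+1) ≤ 2N`
suffices. Otherwise the bounds `n³` and `q^k n²` are averaged geometrically with weight `l =
1/(k+1)` on the second, the choice for which the powers of `q` and `N` cancel and leave
`(n/N)^(3-l)`. -/
theorem energy_le_rpow {k : ℕ} {q N n L s : ℝ} (hq : 0 < q) (hn : 0 < n) (hnN : n ≤ N)
    (hN : q ^ (2 * k + 1) ≤ 2 * N) (h1 : L ≤ n ^ 3)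
    (h2 : L ≤ 3 * (n ^ 3 / q + q ^ k * n ^ 2)) (hs : s ≤ 3 - 1 / (k + 1)) :
    q ^ (2 * k + 2) / N ^ 4 * L ≤ 24 * (n / N) ^ s := by
  have hN0 : 0 < N := hn.trans_le hnN
  have hr0 : 0 < n / N := div_pos hn hN0
  have hr1 : n / N ≤ 1 := (div_le_one hN0).2 hnN
  have hl0 : (0 : ℝ) ≤ 1 / (k + 1) := by positivity
  rcases le_total (q ^ k * n ^ 2) (n ^ 3 / q) with h | h
  · have h3 : q ^ (2 * k + 2) / N ^ 4 * L ≤ 12 * (n / N) ^ 3 :=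
      calc q ^ (2 * k + 2) / N ^ 4 * L ≤ q ^ (2 * k + 2) / N ^ 4 * (6 * (n ^ 3 / q)) := by
            gcongr; linarith
        _ = 6 * q ^ (2 * k + 1) / N * (n / N) ^ 3 := by
            field_simp
            ring
        _ ≤ 6 * (2 * N) / N * (n / N) ^ 3 := by gcongr
        _ = 12 * (n / N) ^ 3 := by field_simp; ring
    have h4 : (n / N) ^ 3 ≤ (n / N) ^ s := by
      rw [← Real.rpow_natCast]
      exact Real.rpow_le_rpow_of_exponent_ge hr0 hr1 (by push_cast; linarith)
    have h5 : 0 ≤ (n / N) ^ s := by positivity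
    linarith
  · set l : ℝ := 1 / (k + 1) with hl
    have hk : l * k = 1 - l := by rw [hl]; field_simp; ring
    have hl1 : l ≤ 1 := by
      rw [hl, div_le_one (by positivity)]
      linarith [Nat.cast_nonneg (α := ℝ) k]
    have ea := Real.exp_log hn
    have eb := Real.exp_log hN0
    have ec := Real.exp_log hq
    set a := Real.log n
    set b := Real.log N
    set c := Real.log q
    have hpow (x : ℝ) (i : ℕ) : Real.exp x ^ i = Real.exp (i * x) := (Real.exp_nat_mul x i).symm
    have h3 : L / 6 ≤ Real.exp (3 * a) := by
      have : Real.exp (3 * a) = n ^ 3 := by rw [← ea, hpow]; norm_num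
      rw [this]
      have : 0 < n ^ 3 := by positivity
      linarith
    have h4 : L / 6 ≤ Real.exp (k * c + 2 * a) := by
      have : Real.exp (k * c + 2 * a) = q ^ k * n ^ 2 := by
        rw [Real.exp_add, ← ea, ← ec, hpow, hpow]; norm_num
      rw [this]
      linarith
    have h5 := le_exp_convexComb h3 h4 hl0 hl1
    have h6 : (2 * k + 1) * c ≤ Real.log 2 + b := by
      have h7 := Real.log_le_log (by positivity) hN
      rw [Real.log_pow, Real.log_mul (by norm_num) hN0.ne'] at h7
      push_cast at h7
      exact h7
    have h7 := mul_le_mul_of_nonneg_left h6 (show 0 ≤ 1 + l by linarith)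
    have h8 : (n / N) ^ (3 - l) ≤ (n / N) ^ s :=
      Real.rpow_le_rpow_of_exponent_ge hr0 hr1 hs
    have h9 : (n / N) ^ (3 - l) = Real.exp ((3 - l) * (a - b)) := by
      rw [Real.rpow_def_of_pos hr0, Real.log_div hn.ne' hN0.ne', mul_comm]
    have h10 : q ^ (2 * k + 2) / N ^ 4 = Real.exp ((2 * k + 2) * c - 4 * b) := by
      rw [Real.exp_sub, ← eb, ← ec, hpow, hpow]
      push_cast
      rfl
    have hlog2 : 0 ≤ Real.log 2 := Real.log_nonneg (by norm_num)
    have h11 : Real.exp ((2 * k + 2) * c - 4 * b)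
        * Real.exp ((1 - l) * (3 * a) + l * (k * c + 2 * a)) ≤ 4 * Real.exp ((3 - l) * (a - b)) := by
      have h4e : (4 : ℝ) = Real.exp (2 * Real.log 2) := by
        rw [mul_comm, Real.exp_mul, Real.exp_log (by norm_num)]; norm_num
      rw [← Real.exp_add]
      refine le_trans ?_ (mul_le_mul_of_nonneg_right h4e.ge (Real.exp_nonneg _))
      rw [← Real.exp_add]
      refine Real.exp_le_exp.2 ?_
      have e1 : l * (k * c + 2 * a) = (1 - l) * c + 2 * l * a := by
        linear_combination c * hk
      -- The total power of `q` is `2k + 3 - l = (1 + l)(2k + 1)`, so raising `q^(2k+1) ≤ 2N` to the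
      -- power `1 + l` removes it, at the cost of `2^(1+l) ≤ 4`.
      have e2 : (1 + l) * ((2 * k + 1) * c) = (2 * k + 1) * c + 2 * (1 - l) * c + l * c := by
        linear_combination 2 * c * hk
      rw [e1]
      rw [e2] at h7
      nlinarith [mul_nonneg (sub_nonneg.2 hl1) hlog2]
    calc q ^ (2 * k + 2) / N ^ 4 * L = 6 * (q ^ (2 * k + 2) / N ^ 4 * (L / 6)) := by ring
      _ ≤ 6 * (q ^ (2 * k + 2) / N ^ 4
            * Real.exp ((1 - l) * (3 * a) + l * (k * c + 2 * a))) := by gcongr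
      _ ≤ 6 * (4 * Real.exp ((3 - l) * (a - b))) := by rw [h10]; gcongr
      _ = 24 * (n / N) ^ (3 - l) := by rw [h9]; ring
      _ ≤ 24 * (n / N) ^ s := by gcongr

end Numerics

/-! ### From indicator-like functions to all functions by dyadic decomposition. -/

section Extension

variable {F : Type*} [Field F] [Fintype F]

/-- The extension estimate for functions comparable to an indicator function. -/
theorem massLpNorm_surfaceFourier_le (hF : ringChar F ≠ 2) {χ : AddChar F ℂ} (hχ : χ ≠ 1)
    {d k : ℕ} (hd : d = 2 * k + 2) {j : F} (hj : j ≠ 0) {s : ℝ} (hs : 4 * s ≤ 3 - 1 / (k + 1))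
    (E : Finset (ffSphere F d j)) (g : ffSphere F d j → ℂ) {t : ℝ} (ht : 0 ≤ t)
    (hg : ∀ x, ‖g x‖ ≤ t) (hg0 : ∀ x, x ∉ E → g x = 0) :
    massLpNorm 1 4 (surfaceFourier (ffSphere F d j) χ g)
      ≤ 3 * t * (((ffSphere F d j).card : ℝ)⁻¹ * E.card) ^ s := by
  classical
  refine massLpNorm_four_le (by positivity) ?_
  set E' := E.map (Function.Embedding.subtype _) with hE'
  have hE'S : E' ⊆ ffSphere F d j := fun x hx => by
    obtain ⟨y, _, rfl⟩ := Finset.mem_map.1 hx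
    exact y.2
  have hcard : E'.card = E.card := Finset.card_map _
  refine (sum_norm_surfaceFourier_pow_four_le hχ _ E g ht hg hg0).trans ?_
  rcases E.eq_empty_or_nonempty with rfl | hne
  · have h0 : E'.addEnergy E' = 0 := by simp [hE']
    rw [h0]
    simp only [Nat.cast_zero, mul_zero]
    positivity
  have hn : (0 : ℝ) < E.card := by exact_mod_cast hne.card_pos
  have hnN : (E.card : ℝ) ≤ (ffSphere F d j).card := by
    rw [← hcard]
    exact_mod_cast Finset.card_le_card hE'S
  have hN : (Fintype.card F : ℝ) ^ (2 * k + 1) ≤ 2 * (ffSphere F d j).card := by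
    subst hd
    exact card_ffSphere_ge hF hχ ⟨k + 1, by omega⟩ hj
  have h1 : (E'.addEnergy E' : ℝ) ≤ (E.card : ℝ) ^ 3 := by
    rw [← hcard]
    exact_mod_cast addEnergy_le_card_pow_three E'
  have h2 := addEnergy_le_of_subset_sphere hF hχ hd hj E' hE'S
  rw [hcard] at h2
  have h3 := energy_le_rpow (k := k) (by exact_mod_cast Fintype.card_pos (α := F)) hn hnN hN h1 h2 hs
  rw [← hd] at h3
  calc _ = t ^ 4 * ((Fintype.card F : ℝ) ^ d / ((ffSphere F d j).card : ℝ) ^ 4 * E'.addEnergy E') := by ring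
    _ ≤ t ^ 4 * (24 * ((E.card : ℝ) / (ffSphere F d j).card) ^ (4 * s)) := by gcongr
    -- Rounding `24` up to `81 = 3⁴` makes the fourth root an integer.
    _ ≤ t ^ 4 * (81 * ((E.card : ℝ) / (ffSphere F d j).card) ^ (4 * s)) := by gcongr; norm_num
    _ = (3 * t * (((ffSphere F d j).card : ℝ)⁻¹ * E.card) ^ s) ^ 4 := by
      rw [mul_comm 4 s, Real.rpow_mul (by positivity), inv_mul_eq_div]
      norm_cast
      ring

/-- The part of `f` of size at most `τ`. -/
noncomputable def truncation {α : Type*} (f : α → ℂ) (τ : ℝ) : α → ℂ :=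
  open Classical in fun x => if ‖f x‖ ≤ τ then f x else 0

theorem norm_truncation_le {α : Type*} (f : α → ℂ) {τ : ℝ} (hτ : 0 ≤ τ) (x : α) :
    ‖truncation f τ x‖ ≤ τ := by
  unfold truncation
  split_ifs with h
  · exact h
  · simpa using hτ

/-- Dyadic decomposition: an estimate for functions comparable to indicator functions gives the
estimate for all functions, up to the number of dyadic scales. -/
theorem massLpNorm_truncation_le {d : ℕ} {S : Finset (Fin d → F)} {χ : AddChar F ℂ} {p : ℝ≥0∞}
    (hp0 : p ≠ 0) {A : ℝ}
    (hA : ∀ (E : Finset S) (g : S → ℂ) (t : ℝ), 0 ≤ t → (∀ x, ‖g x‖ ≤ t) →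
      (∀ x, x ∉ E → g x = 0) → massLpNorm 1 4 (surfaceFourier S χ g)
        ≤ A * t * ((S.card : ℝ)⁻¹ * E.card) ^ (1 / p.toReal)) (hA0 : 0 ≤ A)
    (f : S → ℂ) {M : ℝ} (hM : 0 ≤ M) (K : ℕ) :
    massLpNorm 1 4 (surfaceFourier S χ (truncation f M))
      ≤ 2 * A * K * massLpNorm ((S.card : ℝ)⁻¹) p f
        + massLpNorm 1 4 (surfaceFourier S χ (truncation f (M / 2 ^ K))) := by
  classical
  induction K with
  | zero => simp
  | succ K ih =>
    set τ := M / 2 ^ K with hτ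
    have hτ0 : 0 ≤ τ := by positivity
    have hτ2 : M / 2 ^ (K + 1) = τ / 2 := by rw [hτ, pow_succ, div_div]
    rw [hτ2]
    -- On this shell `τ` bounds `|f|` above and `τ/2` bounds it below, so Chebyshev's inequality
    -- loses only the factor `2` in `2 * A`.
    set E : Finset S := Finset.univ.filter fun x => τ / 2 < ‖f x‖ ∧ ‖f x‖ ≤ τ with hE
    set g : S → ℂ := fun x => if x ∈ E then f x else 0 with hg
    have hsplit : truncation f τ = g + truncation f (τ / 2) := by
      ext x
      simp only [truncation, hg, hE, Pi.add_apply, Finset.mem_filter, Finset.mem_univ, true_and]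
      by_cases h1 : ‖f x‖ ≤ τ / 2
      · have h2 : ‖f x‖ ≤ τ := by linarith
        simp [h1, h2, not_lt.2 h1]
      · by_cases h2 : ‖f x‖ ≤ τ <;> simp [h1, h2, not_le.1 h1]
    have hf0 : 0 ≤ massLpNorm ((S.card : ℝ)⁻¹) p f := massLpNorm_nonneg (by positivity) p f
    have hgle : massLpNorm 1 4 (surfaceFourier S χ g)
        ≤ 2 * A * massLpNorm ((S.card : ℝ)⁻¹) p f := by
      rcases E.eq_empty_or_nonempty with he | hne
      · have h := hA E g 0 le_rfl (fun x => by simp [hg, he]) (fun x hx => by simp [hg, hx])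
        rw [mul_zero, zero_mul] at h
        exact h.trans (by positivity)
      · have h := hA E g τ hτ0 (fun x => by
          by_cases hx : x ∈ E
          · simpa [hg, hx] using (Finset.mem_filter.1 hx).2.2
          · simpa [hg, hx] using hτ0) (fun x hx => by simp [hg, hx])
        have h' := mul_card_rpow_le_massLpNorm (w := (S.card : ℝ)⁻¹) (by positivity) hp0 f E hne
          (t := τ / 2) (by positivity) (fun x hx => (Finset.mem_filter.1 hx).2.1.le)
        calc _ ≤ A * τ * ((S.card : ℝ)⁻¹ * E.card) ^ (1 / p.toReal) := h
          _ = 2 * A * (τ / 2 * ((S.card : ℝ)⁻¹ * E.card) ^ (1 / p.toReal)) := by ring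
          _ ≤ _ := by gcongr
    have htri : massLpNorm 1 4 (surfaceFourier S χ (truncation f τ))
        ≤ massLpNorm 1 4 (surfaceFourier S χ g)
          + massLpNorm 1 4 (surfaceFourier S χ (truncation f (τ / 2))) := by
      rw [hsplit, surfaceFourier_add]
      exact massLpNorm_four_add_le _ _
    push_cast
    linarith

/-- After `K` halvings, with `2^K ≥ |S|`, the remainder is at most `M/|S| ≤ M |S|^(-1/p)`, by `1/p ≤
1`. This is at most the `L^p` norm of `f`, as one sees at the single point where `|f| = M`. The
remainder thus costs one more `A`, for a total of `A(2K + 1)`. -/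
theorem extensionEstimate_of_indicator {d : ℕ} {S : Finset (Fin d → F)} (hS : S.Nonempty)
    {χ : AddChar F ℂ} {p : ℝ≥0∞} (hp0 : p ≠ 0) (hp1 : 1 / p.toReal ≤ 1) {A : ℝ} (hA0 : 0 ≤ A)
    (hA : ∀ (E : Finset S) (g : S → ℂ) (t : ℝ), 0 ≤ t → (∀ x, ‖g x‖ ≤ t) →
      (∀ x, x ∉ E → g x = 0) → massLpNorm 1 4 (surfaceFourier S χ g)
        ≤ A * t * ((S.card : ℝ)⁻¹ * E.card) ^ (1 / p.toReal)) :
    ExtensionEstimate S χ p 4 (A * (2 * Nat.log 2 S.card + 3)) := by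
  intro f
  have : Nonempty S := hS.to_subtype
  obtain ⟨x₀, _, hx₀⟩ := Finset.exists_max_image Finset.univ (fun x => ‖f x‖) Finset.univ_nonempty
  set M := ‖f x₀‖ with hM
  set K := Nat.log 2 S.card + 1 with hK
  have hM0 : 0 ≤ M := norm_nonneg _
  have hN : (1 : ℝ) ≤ S.card := by exact_mod_cast hS.card_pos
  have htrunc : truncation f M = f := by
    ext x
    rw [truncation, if_pos (hx₀ x (Finset.mem_univ x))]
  have h1 := massLpNorm_truncation_le hp0 hA hA0 f hM0 K
  rw [htrunc] at h1
  have h2 := hA Finset.univ (truncation f (M / 2 ^ K)) (M / 2 ^ K) (by positivity)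
    (norm_truncation_le f (by positivity)) (fun x hx => absurd (Finset.mem_univ x) hx)
  have h3 := mul_card_rpow_le_massLpNorm (w := (S.card : ℝ)⁻¹) (by positivity) hp0 f {x₀}
    (Finset.singleton_nonempty _) hM0 (fun x hx => by rw [Finset.mem_singleton.1 hx])
  rw [Finset.card_singleton, Nat.cast_one, mul_one] at h3
  rw [Finset.card_univ, Fintype.card_coe, inv_mul_cancel₀ (by positivity), Real.one_rpow,
    mul_one] at h2
  have h4 : M / 2 ^ K ≤ M * ((S.card : ℝ)⁻¹) ^ (1 / p.toReal) := by
    rw [div_eq_mul_inv]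
    refine mul_le_mul_of_nonneg_left ?_ hM0
    have h5 : (S.card : ℝ) ≤ 2 ^ K := by
      exact_mod_cast (Nat.lt_pow_succ_log_self one_lt_two S.card).le
    calc ((2 : ℝ) ^ K)⁻¹ ≤ (S.card : ℝ)⁻¹ := inv_anti₀ (by positivity) h5
      _ = ((S.card : ℝ)⁻¹) ^ (1 : ℝ) := (Real.rpow_one _).symm
      _ ≤ _ := Real.rpow_le_rpow_of_exponent_ge (by positivity) (inv_le_one_of_one_le₀ hN) hp1
  have h6 : A * (M / 2 ^ K) ≤ A * massLpNorm ((S.card : ℝ)⁻¹) p f :=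
    mul_le_mul_of_nonneg_left (h4.trans h3) hA0
  have hK' : (K : ℝ) = Nat.log 2 S.card + 1 := by rw [hK]; push_cast; rfl
  rw [hK'] at h1
  calc _ ≤ _ := h1
    _ ≤ 2 * A * (Nat.log 2 S.card + 1) * massLpNorm ((S.card : ℝ)⁻¹) p f
        + A * massLpNorm ((S.card : ℝ)⁻¹) p f := by gcongr; exact h2.trans h6
    _ = _ := by ring

theorem natLog_card_le {d : ℕ} (S : Finset (Fin d → F)) (hS : S.Nonempty) {ε : ℝ} (hε : 0 < ε) :
    (Nat.log 2 S.card : ℝ) ≤ d / (ε * Real.log 2) * (Fintype.card F : ℝ) ^ ε := by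
  have hN : (S.card : ℝ) ≤ (Fintype.card F : ℝ) ^ d := by
    have h := Finset.card_le_univ S
    rw [Fintype.card_pi, Finset.prod_const, Finset.card_univ, Fintype.card_fin] at h
    exact_mod_cast h
  have hlog2 : 0 < Real.log 2 := Real.log_pos one_lt_two
  have hN0 : (0 : ℝ) < S.card := by exact_mod_cast hS.card_pos
  calc (Nat.log 2 S.card : ℝ) ≤ Real.logb 2 S.card := by exact_mod_cast Real.natLog_le_logb S.card 2
    _ = Real.log S.card / Real.log 2 := rfl
    _ ≤ (d * Real.log (Fintype.card F)) / Real.log 2 := by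
      rw [← Real.log_pow]
      gcongr
    _ ≤ (d * ((Fintype.card F : ℝ) ^ ε / ε)) / Real.log 2 := by
      gcongr
      exact Real.log_le_rpow_div (Nat.cast_nonneg _) hε
    _ = _ := by field_simp

end Extension

/-! ### The range of exponents and the conclusion. -/

/-- With `d = 2k + 2` the bound is `4/p ≤ 3 - 2/d`, and the hypothesis is slightly stronger because
`4d/(3d-2) < (12d-8)/(9d-12)`. For `p = ∞` the convention `∞.toReal = 0` makes `1/p` equal to `0`,
as it should be. -/
theorem four_mul_inv_toReal_le {k : ℕ} {p : ℝ≥0∞}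
    (hp : ENNReal.ofReal ((12 * ((2 * k + 2 : ℕ) : ℝ) - 8) / (9 * ((2 * k + 2 : ℕ) : ℝ) - 12)) ≤ p)
    (hk : 1 ≤ k) : p ≠ 0 ∧ 4 * (1 / p.toReal) ≤ 3 - 1 / (k + 1) := by
  have hk' : (1 : ℝ) ≤ k := by exact_mod_cast hk
  push_cast at hp
  have hden : 0 < 9 * (2 * (k : ℝ) + 2) - 12 := by linarith
  have hnum : 0 < 12 * (2 * (k : ℝ) + 2) - 8 := by linarith
  have hpos := div_pos hnum hden
  refine ⟨(lt_of_lt_of_le (ENNReal.ofReal_pos.2 hpos) hp).ne', ?_⟩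
  by_cases htop : p = ∞
  · subst htop
    have : 1 / ((k : ℝ) + 1) ≤ 1 := by
      rw [div_le_one (by positivity)]; linarith
    simp only [ENNReal.toReal_top, div_zero, mul_zero]
    linarith
  · have h1 := (ENNReal.ofReal_le_iff_le_toReal htop).1 hp
    have h2 := one_div_le_one_div_of_le hpos h1
    rw [one_div_div] at h2
    refine (mul_le_mul_of_nonneg_left h2 (by norm_num)).trans ?_
    rw [← mul_div_assoc, le_sub_iff_add_le, div_add_div _ _ hnum.ne' (by positivity),
      div_le_iff₀ (by positivity)]
    nlinarith

theorem theorem1p1 (d : ℕ) (hd : 4 ≤ d) (hd_even : Even d) :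
    (∀ p : ℝ≥0∞, ENNReal.ofReal ((12 * (d : ℝ) - 8) / (9 * (d : ℝ) - 12)) ≤ p →
      ∀ ε : ℝ, 0 < ε → ∃ C : ℝ, 0 < C ∧
        ∀ (F : Type*) [Field F] [Fintype F], ringChar F ≠ 2 →
          ∀ χ : AddChar F ℂ, χ ≠ 1 → ∀ j : F, j ≠ 0 →
            RStar (ffSphere F d j) χ p 4 ≤ ENNReal.ofReal (C * (Fintype.card F : ℝ) ^ ε)) ∧
    (12 * (d : ℝ) - 8) / (9 * (d : ℝ) - 12) < (4 * (d : ℝ) - 4) / (3 * (d : ℝ) - 5) := by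

  obtain ⟨k, hk⟩ := hd_even
  obtain ⟨k, rfl⟩ : ∃ i, k = i + 1 := ⟨k - 1, by omega⟩
  have hdk : d = 2 * k + 2 := by omega
  have hk1 : 1 ≤ k := by omega
  clear hk
  refine ⟨fun p hp ε hε => ?_, ?_⟩
  · rw [hdk] at hp
    obtain ⟨hp0, hs⟩ := four_mul_inv_toReal_le hp hk1
    have hp1 : 1 / p.toReal ≤ 1 := by
      have : (0 : ℝ) ≤ 1 / (k + 1) := by positivity
      linarith
    have hlog2 : 0 < Real.log 2 := Real.log_pos one_lt_two
    -- The constant comes from bounding `log₂ |S|` by `d q^ε / (ε log 2)` in `3(2 log₂ |S| + 3)` and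
    -- using `1 ≤ q^ε`.
    refine ⟨3 * (2 * (d / (ε * Real.log 2)) + 3), by positivity, ?_⟩
    intro F _ _ hF χ hχ j hj
    classical
    set S := ffSphere F d j with hS
    have hne : S.Nonempty := by
      rw [← Finset.card_pos]
      subst hdk
      have h := card_ffSphere_ge hF hχ (m := 2 * k + 1) ⟨k + 1, by omega⟩ hj
      have hq : (0 : ℝ) < (Fintype.card F : ℝ) ^ (2 * k + 1) :=
        pow_pos (by exact_mod_cast Fintype.card_pos (α := F)) _
      have h' : (0 : ℝ) < S.card := by linarith
      exact_mod_cast h'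
    have hest := extensionEstimate_of_indicator (χ := χ) hne hp0 hp1 (by norm_num : (0 : ℝ) ≤ 3)
      (fun E g t ht hg hg0 => massLpNorm_surfaceFourier_le hF hχ hdk hj hs E g ht hg hg0)
    set B : ℝ := 3 * (2 * Nat.log 2 S.card + 3) with hB
    have hB0 : 0 ≤ B := by positivity
    have hR : RStar S χ p 4 ≤ ENNReal.ofReal B :=
      iInf₂_le (⟨B, hB0⟩ : ℝ≥0) hest |>.trans_eq (ENNReal.ofReal_eq_coe_nnreal hB0).symm
    refine hR.trans (ENNReal.ofReal_le_ofReal ?_)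
    have h1 := natLog_card_le S hne hε
    have h2 : 1 ≤ (Fintype.card F : ℝ) ^ ε :=
      Real.one_le_rpow (by exact_mod_cast Fintype.card_pos (α := F)) hε.le
    rw [hB]
    linarith
  · have h4 : (4 : ℝ) ≤ d := by exact_mod_cast hd
    rw [div_lt_div_iff₀ (by linarith) (by linarith)]
    nlinarith
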